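/- Let $\mathcal D$ be a probability distribution on $[0,1]$. There are $n$ voters and $m$ alternatives. A preference profile $\sigma=(\sigma_1,\dots,\sigma_n)$ consists of a strict ranking of the $m$ alternatives for each voter, and a (deterministic) voting rule $f$ maps each profile $\sigma$ to an alternative $f(\sigma)$. Given $\sigma$, each voter $i$ independently draws $m$ i.i.d. values from $\mathcal D$, and these are assigned, from highest to lowest, to the alternatives in the order of $\sigma_i$; let $u_{ij}$ be the resulting utility of voter $i$ for alternative $j$, and let $\mathrm{sw}(j,u)=\sum_{i=1}^n u_{ij}$. Put $$\mathrm{SW}(f,\sigma)=\mathrm{sw}(f(\sigma),u),\qquad \mathrm{dist}(f,\sigma)=\frac{\mathrm{sw}(f(\sigma),u)}{\max_j \mathrm{sw}(j,u)},$$ where the second quotient is given an arbitrary fixed value $c\in[0,1]$ on the event that it reads $0/0$. A rule $f$ is an expected-welfare-maximizing rule (EWMR) if for every $\sigma$ it maximizes $\mathbb E[\mathrm{SW}(f,\sigma)]$ among all rules, and an expected-distortion-maximizing rule (EDMR) if for every $\sigma$ it maximizes $\mathbb E[\mathrm{dist}(f,\sigma)]$ among all rules. (1) For all $\mu$, $s$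 and every $\epsilon>0$ there exists $n_0$, depending only on $\mu$, $s$ and $\epsilon$, such that for every distribution $\mathcal D$ on $[0,1]$ with mean $\mu$ and variance $s^2$, for all $n\ge n_0$ and all $m$, for every EWMR, every EDMR and every preference profile $\sigma$, $$\mathbb E[\mathrm{dist}(\mathrm{EWMR},\sigma)]\ \ge\ (1-\epsilon)\,\mathbb E[\mathrm{dist}(\mathrm{EDMR},\sigma)].$$ (2) Let $\mathcal D$ be a distribution on $[0,1]$ whose cumulative distribution function $F$ is continuously differentiable on $(0,1)$ with $F'(x)>0$ for all $x\in(0,1)$. Then for every $\epsilon>0$ there exists $m_0$, depending only on $\mathcal D$ and $\epsilon$, such that the same inequality holds for all $m\ge m_0$ and all $n$, for every EWMR, every EDMR and every preference profile $\sigma$. In both parts, $n_0$ and $m_0$ do not depend on the convention $c$. -/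

import Mathlib

open MeasureTheory ProbabilityTheory Set

namespace Voting

/-- A preference profile of `n` voters over `m` alternatives. `σ i j` is the position of
alternative `j` in the ranking of voter `i`; position `0` is the top of the ranking. -/
abbrev Profile (n m : ℕ) : Type := Fin n → Equiv.Perm (Fin m)

/-- A deterministic voting rule. -/
abbrev Rule (n m : ℕ) : Type := Profile n m → Fin m

/-- The `k`-th largest entry of `x`, counted from `k = 0`
(`x ∘ Tuple.sort x` lists the entries in increasing order). -/
noncomputable def descOrderStat {m : ℕ} (x : Fin m → ℝ) (k : Fin m) : ℝ :=
  x (Tuple.sort x k.rev)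

/-- The utility profile that arises from the draws `x i` of each voter `i` by assigning them,
from highest to lowest, to the alternatives in the order of the ranking `σ i`. -/
noncomputable def utility {n m : ℕ} (σ : Profile n m) (x : Fin n → Fin m → ℝ) (i : Fin n) (j : Fin m) : ℝ :=
  descOrderStat (x i) (σ i j)

/-- Utilitarian social welfare of alternative `j` under the utility profile `u`. -/
noncomputable def welfare {n m : ℕ} (u : Fin n → Fin m → ℝ) (j : Fin m) : ℝ :=
  ∑ i, u i j

/-- Ratio of the welfare of `j` to the largest welfare of an alternative. The quotient is `0 / 0`
where no alternative has positive welfare, and `c` is the value that it is given there. -/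
noncomputable def welfareRatio {n m : ℕ} (c : ℝ) (u : Fin n → Fin m → ℝ) (j : Fin m) : ℝ :=
  open Classical in
  if (⨆ k, welfare u k) = 0 then c else welfare u j / ⨆ k, welfare u k

/-- The law of the draws: `m` independent draws from `D` for each of the `n` voters. -/
noncomputable def drawLaw (D : Measure ℝ) (n m : ℕ) : Measure (Fin n → Fin m → ℝ) :=
  Measure.pi fun _ => Measure.pi fun _ => D

/-- Expected social welfare of the rule `f` at the profile `σ`. -/
noncomputable def expWelfare {n m : ℕ} (D : Measure ℝ) (f : Rule n m) (σ : Profile n m) : ℝ :=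
  ∫ x, welfare (utility σ x) (f σ) ∂(drawLaw D n m)

/-- Expected (distributional) distortion of the rule `f` at the profile `σ`. -/
noncomputable def expDistortion {n m : ℕ} (c : ℝ) (D : Measure ℝ) (f : Rule n m)
    (σ : Profile n m) : ℝ :=
  ∫ x, welfareRatio c (utility σ x) (f σ) ∂(drawLaw D n m)

/-- `f` is an expected-welfare-maximizing rule. -/
def IsEWMR {n m : ℕ} (D : Measure ℝ) (f : Rule n m) : Prop :=
  ∀ σ : Profile n m, ∀ g : Rule n m, expWelfare D g σ ≤ expWelfare D f σ

/-- `f` is an expected-distortion-maximizing rule. -/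
def IsEDMR {n m : ℕ} (c : ℝ) (D : Measure ℝ) (f : Rule n m) : Prop :=
  ∀ σ : Profile n m, ∀ g : Rule n m, expDistortion c D g σ ≤ expDistortion c D f σ

/-- `f` is an `α`-expected-distortion-maximizing rule. -/
def IsApproxEDMR {n m : ℕ} (c : ℝ) (D : Measure ℝ) (α : ℝ) (f : Rule n m) : Prop :=
  ∀ g : Rule n m, IsEDMR c D g →
    ∀ σ : Profile n m, α * expDistortion c D g σ ≤ expDistortion c D f σ

end Voting

namespace Voting

/-! ### Order statistics -/

/-! Let `W` be the largest welfare and `A` its mean. If `W` is close to `A` in L¹, then the expected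
ratio of every alternative is close to its expected welfare divided by the constant `A`, so
maximizing one almost maximizes the other. The additive error becomes multiplicative because some
alternative has expected welfare at least `n * μ`, by averaging over alternatives, while `A ≤ n`.
Hence the optimal expected ratio is bounded below by nearly `μ` (`isApproxEDMR_of_concentration`).

It remains to show that `E|W - A|` is small compared with `n`. For many voters, redrawing one voter
moves `W` by at most 1, so its variance is at most `n`, whatever `m` and `D` are
(`integral_maxWelfare_sub_sq_le`). For many alternatives, the order statistics of a voter are almost
deterministic, uniformly in the rank, because the tail of `D` is strictly decreasing; the errors of
the voters just add up, which gives a bound linear in `n`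
(`exists_forall_integral_abs_maxWelfare_sub_le`). -/

/-- Trades order statistics for counts of exceedances; both measurability and the quantile estimates
rest on it. -/
theorem lt_descOrderStat_iff {m : ℕ} (x : Fin m → ℝ) (k : Fin m) (t : ℝ) :
    t < descOrderStat x k ↔ (k : ℕ) < Finset.card {j | t < x j} := by
  have hanti : Antitone fun i : Fin m => x (Tuple.sort x i.rev) := fun i j hij =>
    Tuple.monotone_sort x (Fin.rev_le_rev.mpr hij)
  have h := Tuple.lt_card_gt_iff_apply_gt_of_antitone (j := k) (a := t) hanti
  have hcard : Finset.card {i : Fin m | t < x (Tuple.sort x i.rev)} =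
      Finset.card {j | t < x j} :=
    Finset.card_equiv (Fin.revPerm.trans (Tuple.sort x)) (by simp)
  rw [hcard] at h
  exact h.symm

theorem measurable_descOrderStat {m : ℕ} (k : Fin m) :
    Measurable fun x : Fin m → ℝ => descOrderStat x k := by
  refine measurable_of_Ioi fun t => ?_
  have hcount : Measurable fun x : Fin m → ℝ => Finset.card {j | t < x j} := by
    simp_rw [Finset.card_filter]
    refine Finset.measurable_sum _ fun j _ => ?_
    exact Measurable.ite (measurableSet_lt measurable_const (measurable_pi_apply j))
      measurable_const measurable_const
  have : (fun x : Fin m → ℝ => descOrderStat x k) ⁻¹' Ioi t =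
      (fun x : Fin m → ℝ => Finset.card {j | t < x j}) ⁻¹' Ioi (k : ℕ) := by
    ext x
    exact lt_descOrderStat_iff x k t
  rw [this]
  exact hcount (measurableSet_Ioi)

theorem sum_descOrderStat {m : ℕ} (x : Fin m → ℝ) : ∑ k, descOrderStat x k = ∑ j, x j :=
  Equiv.sum_comp (Fin.revPerm.trans (Tuple.sort x)) x

theorem descOrderStat_mem {m : ℕ} {x : Fin m → ℝ} {s : Set ℝ} (hx : ∀ j, x j ∈ s) (k : Fin m) :
    descOrderStat x k ∈ s :=
  hx _

/-! ### Welfare -/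

/-- The largest welfare of an alternative. -/
noncomputable def maxWelfare {n m : ℕ} (σ : Profile n m) (x : Fin n → Fin m → ℝ) : ℝ :=
  ⨆ j, welfare (utility σ x) j

theorem measurable_welfare {n m : ℕ} (σ : Profile n m) (j : Fin m) :
    Measurable fun x => welfare (utility σ x) j :=
  Finset.measurable_sum _ fun i _ => (measurable_descOrderStat (σ i j)).comp (measurable_pi_apply i)

theorem measurable_maxWelfare {n m : ℕ} (σ : Profile n m) : Measurable (maxWelfare σ) :=
  Measurable.iSup fun j => measurable_welfare σ j

theorem welfare_le_maxWelfare {n m : ℕ} (σ : Profile n m) (x : Fin n → Fin m → ℝ) (j : Fin m) :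
    welfare (utility σ x) j ≤ maxWelfare σ x :=
  le_ciSup (Finite.bddAbove_range fun j => welfare (utility σ x) j) j

theorem welfare_mem {n m : ℕ} (σ : Profile n m) {x : Fin n → Fin m → ℝ}
    (hx : ∀ i j, x i j ∈ Icc (0 : ℝ) 1) (j : Fin m) :
    welfare (utility σ x) j ∈ Icc (0 : ℝ) n := by
  refine ⟨Finset.sum_nonneg fun i _ => (hx i _).1, ?_⟩
  calc ∑ i, utility σ x i j ≤ ∑ _i : Fin n, (1 : ℝ) := Finset.sum_le_sum fun i _ => (hx i _).2
    _ = n := by simp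

theorem maxWelfare_mem {n m : ℕ} [Nonempty (Fin m)] (σ : Profile n m) {x : Fin n → Fin m → ℝ}
    (hx : ∀ i j, x i j ∈ Icc (0 : ℝ) 1) : maxWelfare σ x ∈ Icc (0 : ℝ) n :=
  ⟨(welfare_mem σ hx (Classical.arbitrary _)).1.trans (welfare_le_maxWelfare σ x _),
    ciSup_le fun j => (welfare_mem σ hx j).2⟩

theorem sum_welfare {n m : ℕ} (σ : Profile n m) (x : Fin n → Fin m → ℝ) :
    ∑ j, welfare (utility σ x) j = ∑ i, ∑ j, x i j := by
  unfold welfare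
  rw [Finset.sum_comm]
  refine Finset.sum_congr rfl fun i _ => ?_
  rw [← sum_descOrderStat (x i)]
  exact Equiv.sum_comp (σ i) (descOrderStat (x i))

/-- A maximum is 1-Lipschitz in the sup norm. Both concentration arguments start here, with
different choices of `b`. -/
theorem abs_maxWelfare_sub_le {n m : ℕ} [Nonempty (Fin m)] (σ : Profile n m)
    {x y : Fin n → Fin m → ℝ} {b : Fin n → ℝ}
    (h : ∀ i k, |descOrderStat (x i) k - descOrderStat (y i) k| ≤ b i) :
    |maxWelfare σ x - maxWelfare σ y| ≤ ∑ i, b i := by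
  have key : ∀ x y : Fin n → Fin m → ℝ,
      (∀ i k, |descOrderStat (x i) k - descOrderStat (y i) k| ≤ b i) →
      maxWelfare σ x ≤ maxWelfare σ y + ∑ i, b i := by
    intro x y h
    refine ciSup_le fun j => ?_
    have h1 : welfare (utility σ x) j ≤ welfare (utility σ y) j + ∑ i, b i := by
      unfold welfare
      rw [← Finset.sum_add_distrib]
      refine Finset.sum_le_sum fun i _ => ?_
      have := (abs_le.mp (h i (σ i j))).2
      unfold utility
      linarith
    exact h1.trans (by gcongr; exact welfare_le_maxWelfare σ y j)
  rw [abs_le]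
  have h1 := key x y h
  have h2 := key y x fun i k => by rw [abs_sub_comm]; exact h i k
  constructor <;> linarith

/-! ### The law of the draws -/

instance (D : Measure ℝ) [IsProbabilityMeasure D] (n m : ℕ) :
    IsProbabilityMeasure (drawLaw D n m) := by
  unfold drawLaw; infer_instance

theorem measurePreserving_draw (D : Measure ℝ) [IsProbabilityMeasure D] {n m : ℕ} (i : Fin n)
    (j : Fin m) : MeasurePreserving (fun x : Fin n → Fin m → ℝ => x i j) (drawLaw D n m) D :=
  (measurePreserving_eval (fun _ : Fin m => D) j).comp
    (measurePreserving_eval (fun _ : Fin n => Measure.pi fun _ : Fin m => D) i)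

theorem ae_drawLaw_mem {D : Measure ℝ} [IsProbabilityMeasure D] {s : Set ℝ}
    (hD : ∀ᵐ x ∂D, x ∈ s) (n m : ℕ) : ∀ᵐ x ∂drawLaw D n m, ∀ i j, x i j ∈ s := by
  simp only [ae_all_iff]
  exact fun i j => (measurePreserving_draw D i j).quasiMeasurePreserving.ae hD

section
variable {D : Measure ℝ} [IsProbabilityMeasure D] {n m : ℕ}

theorem integrable_welfare (hD : ∀ᵐ x ∂D, x ∈ Icc (0 : ℝ) 1) (σ : Profile n m) (j : Fin m) :
    Integrable (fun x => welfare (utility σ x) j) (drawLaw D n m) :=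
  .of_mem_Icc 0 n (measurable_welfare σ j).aemeasurable <| by
    filter_upwards [ae_drawLaw_mem hD n m] with x hx using welfare_mem σ hx j

theorem integrable_maxWelfare [Nonempty (Fin m)] (hD : ∀ᵐ x ∂D, x ∈ Icc (0 : ℝ) 1)
    (σ : Profile n m) : Integrable (maxWelfare σ) (drawLaw D n m) :=
  .of_mem_Icc 0 n (measurable_maxWelfare σ).aemeasurable <| by
    filter_upwards [ae_drawLaw_mem hD n m] with x hx using maxWelfare_mem σ hx

theorem sum_integral_welfare (hD : ∀ᵐ x ∂D, x ∈ Icc (0 : ℝ) 1) (σ : Profile n m) :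
    ∑ j, ∫ x, welfare (utility σ x) j ∂drawLaw D n m = m * (n * ∫ x, x ∂D) := by
  have hdraw : ∀ (i : Fin n) (j : Fin m),
      Integrable (fun x : Fin n → Fin m → ℝ => x i j) (drawLaw D n m) := fun i j =>
    .of_mem_Icc 0 1 (measurePreserving_draw D i j).measurable.aemeasurable <| by
      filter_upwards [ae_drawLaw_mem hD n m] with x hx using hx i j
  have hmean : ∀ (i : Fin n) (j : Fin m), ∫ x, x i j ∂drawLaw D n m = ∫ x, x ∂D := fun i j => by
    have h := integral_map (μ := drawLaw D n m) (f := fun x : ℝ => x)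
      (measurePreserving_draw (n := n) D i j).measurable.aemeasurable
      measurable_id.aestronglyMeasurable
    rw [(measurePreserving_draw D i j).map_eq] at h
    exact h.symm
  rw [← integral_finsetSum _ fun j _ => integrable_welfare hD σ j]
  simp_rw [sum_welfare]
  rw [integral_finsetSum _ fun i _ => integrable_finsetSum _ fun j _ => hdraw i j]
  simp_rw [integral_finsetSum _ fun j _ => hdraw _ j, hmean]
  simp
  ring

theorem exists_mean_le_integral_welfare [Nonempty (Fin m)] (hD : ∀ᵐ x ∂D, x ∈ Icc (0 : ℝ) 1)
    (σ : Profile n m) : ∃ j, n * ∫ x, x ∂D ≤ ∫ x, welfare (utility σ x) j ∂drawLaw D n m := by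
  obtain ⟨j, -, hj⟩ := Finset.exists_le_of_sum_le (s := Finset.univ)
    (f := fun _ : Fin m => n * ∫ x, x ∂D)
    (g := fun j => ∫ x, welfare (utility σ x) j ∂drawLaw D n m) Finset.univ_nonempty
    (by rw [sum_integral_welfare hD σ]; simp)
  exact ⟨j, hj⟩

end

/-! ### Comparison of expected ratios with ratios of expectations -/

/-- For `W ≠ 0` the difference is `S / W * ((A - W) / A)` with `S / W ≤ 1`. For `W = 0` the right
side is 1, which absorbs any `c` in `[0, 1]`; this makes the thresholds independent of the
convention. -/
theorem abs_welfareRatio_sub_le {c A W S r : ℝ} (hc : c ∈ Icc (0 : ℝ) 1) (hA : 0 < A)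
    (hS : 0 ≤ S) (hSW : S ≤ W) (hr : r = if W = 0 then c else S / W) :
    |r - S / A| ≤ |W - A| / A := by
  subst hr
  split_ifs with hW
  · have hS0 : S = 0 := le_antisymm (hSW.trans hW.le) hS
    rw [hS0, hW, zero_sub, abs_neg, abs_of_pos hA, div_self hA.ne', zero_div, sub_zero,
      abs_of_nonneg hc.1]
    exact hc.2
  · have hWpos : 0 < W := lt_of_le_of_ne (hS.trans hSW) (Ne.symm hW)
    have : S / W - S / A = S / W * ((A - W) / A) := by field_simp
    rw [this, abs_mul, abs_div, abs_div, abs_of_nonneg hS, abs_of_pos hWpos, abs_of_pos hA,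
      abs_sub_comm]
    exact mul_le_of_le_one_left (by positivity) ((div_le_one hWpos).mpr hSW)

theorem measurable_welfareRatio {n m : ℕ} (c : ℝ) (σ : Profile n m) (j : Fin m) :
    Measurable fun x => welfareRatio c (utility σ x) j :=
  Measurable.ite (measurable_maxWelfare σ (measurableSet_singleton 0)) measurable_const
    ((measurable_welfare σ j).div (measurable_maxWelfare σ))

theorem welfareRatio_mem {n m : ℕ} {c : ℝ} (hc : c ∈ Icc (0 : ℝ) 1) (σ : Profile n m)
    {x : Fin n → Fin m → ℝ} (hx : ∀ i j, x i j ∈ Icc (0 : ℝ) 1) (j : Fin m) :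
    welfareRatio c (utility σ x) j ∈ Icc (0 : ℝ) 1 := by
  unfold welfareRatio
  split_ifs
  · exact hc
  · have h0 := (welfare_mem σ hx j).1
    have h1 := welfare_le_maxWelfare σ x j
    exact ⟨div_nonneg h0 (h0.trans h1), div_le_one_of_le₀ h1 (h0.trans h1)⟩

section
variable {D : Measure ℝ} [IsProbabilityMeasure D] {n m : ℕ} {c : ℝ}

theorem integrable_welfareRatio (hD : ∀ᵐ x ∂D, x ∈ Icc (0 : ℝ) 1) (hc : c ∈ Icc (0 : ℝ) 1)
    (σ : Profile n m) (j : Fin m) :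
    Integrable (fun x => welfareRatio c (utility σ x) j) (drawLaw D n m) :=
  .of_mem_Icc 0 1 (measurable_welfareRatio c σ j).aemeasurable <| by
    filter_upwards [ae_drawLaw_mem hD n m] with x hx using welfareRatio_mem hc σ hx j

theorem abs_integral_welfareRatio_sub_le [Nonempty (Fin m)] (hD : ∀ᵐ x ∂D, x ∈ Icc (0 : ℝ) 1)
    (hc : c ∈ Icc (0 : ℝ) 1) (σ : Profile n m) {A : ℝ} (hA : 0 < A) (j : Fin m) :
    |∫ x, welfareRatio c (utility σ x) j ∂drawLaw D n m -
        (∫ x, welfare (utility σ x) j ∂drawLaw D n m) / A| ≤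
      (∫ x, |maxWelfare σ x - A| ∂drawLaw D n m) / A := by
  rw [← integral_div, ← integral_div, ← integral_sub (integrable_welfareRatio hD hc σ j)
    ((integrable_welfare hD σ j).div_const A)]
  refine (abs_integral_le_integral_abs).trans ?_
  refine integral_mono_ae ?_ ?_ ?_
  · exact ((integrable_welfareRatio hD hc σ j).sub
      ((integrable_welfare hD σ j).div_const A)).abs
  · exact ((integrable_maxWelfare hD σ).sub (integrable_const A)).abs.div_const A
  · filter_upwards [ae_drawLaw_mem hD n m] with x hx
    refine abs_welfareRatio_sub_le hc hA (welfare_mem σ hx j).1 (welfare_le_maxWelfare σ x j) ?_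
    unfold welfareRatio maxWelfare
    congr

/-- If the largest welfare concentrates around its mean then every expected-welfare-maximizing rule
approximately maximizes the expected distortion. -/
theorem isApproxEDMR_of_concentration (hD : ∀ᵐ x ∂D, x ∈ Icc (0 : ℝ) 1)
    (hc : c ∈ Icc (0 : ℝ) 1) (hμ : 0 < ∫ x, x ∂D) (hn : 0 < n) {ε κ : ℝ} (hε : 0 < ε)
    (hε1 : ε ≤ 1) (hκ : κ ≤ (∫ x, x ∂D) * (ε * (∫ x, x ∂D) / 3))
    (hconc : ∀ σ : Profile n m, ∫ x, |maxWelfare σ x - ∫ y, maxWelfare σ y ∂drawLaw D n m|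
      ∂drawLaw D n m ≤ n * κ)
    {f : Rule n m} (hf : IsEWMR D f) : IsApproxEDMR c D (1 - ε) f := by
  intro g hg σ
  have : Nonempty (Fin m) := ⟨f σ⟩
  set μ := ∫ x, x ∂D
  set A := ∫ y, maxWelfare σ y ∂drawLaw D n m with hA
  have hn' : (0 : ℝ) < n := by exact_mod_cast hn
  have hfμ : n * μ ≤ expWelfare D f σ := by
    obtain ⟨j, hj⟩ := exists_mean_le_integral_welfare (n := n) hD σ
    exact hj.trans (hf σ fun _ => j)
  have hfA : expWelfare D f σ ≤ A :=
    integral_mono (integrable_welfare hD σ _) (integrable_maxWelfare hD σ)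
      fun x => welfare_le_maxWelfare σ x _
  have hAn : A ≤ n := by
    refine (integral_mono_ae (integrable_maxWelfare hD σ) (integrable_const (n : ℝ)) ?_).trans_eq
      (by simp)
    filter_upwards [ae_drawLaw_mem hD n m] with x hx using (maxWelfare_mem σ hx).2
  have hApos : 0 < A := (mul_pos hn' hμ).trans_le (hfμ.trans hfA)
  have herr : (∫ x, |maxWelfare σ x - A| ∂drawLaw D n m) / A ≤ ε * μ / 3 := by
    rw [div_le_iff₀ hApos]
    calc _ ≤ n * κ := hconc σ
      _ ≤ n * (μ * (ε * μ / 3)) := by gcongr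
      _ = ε * μ / 3 * (n * μ) := by ring
      _ ≤ ε * μ / 3 * A := by gcongr; exact hfμ.trans hfA
  have hF := abs_le.mp ((abs_integral_welfareRatio_sub_le hD hc σ hApos (f σ)).trans herr)
  have hG := abs_le.mp ((abs_integral_welfareRatio_sub_le hD hc σ hApos (g σ)).trans herr)
  change _ ≤ expDistortion c D f σ - expWelfare D f σ / A ∧ _ at hF
  change _ ∧ expDistortion c D g σ - expWelfare D g σ / A ≤ _ at hG
  have h1 : expWelfare D g σ / A ≤ expWelfare D f σ / A := by gcongr; exact hf σ g
  have h2 : μ ≤ expWelfare D f σ / A := by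
    rw [le_div_iff₀ hApos]
    exact le_trans (by rw [mul_comm]; gcongr) hfμ
  have h3 : expDistortion c D f σ ≤ expDistortion c D g σ := hg σ f
  have h4 : ε * (μ - ε * μ / 3) ≤ ε * expDistortion c D g σ := by
    gcongr; linarith [hF.1]
  -- The two errors cost `2 * ε * μ / 3` in total, and `h4` bounds `ε` times the optimum below by `ε
  -- * μ * (1 - ε / 3)`, which covers this cost since `ε ≤ 1`.
  nlinarith [hF.1, hG.2, mul_pos hε hμ, mul_nonneg (mul_pos hε hμ).le (sub_nonneg.mpr hε1)]

theorem expDistortion_nonneg (hD : ∀ᵐ x ∂D, x ∈ Icc (0 : ℝ) 1) (hc : c ∈ Icc (0 : ℝ) 1)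
    (f : Rule n m) (σ : Profile n m) : 0 ≤ expDistortion c D f σ :=
  integral_nonneg_of_ae <| by
    filter_upwards [ae_drawLaw_mem hD n m] with x hx using (welfareRatio_mem hc σ hx _).1

theorem IsApproxEDMR.mono (hD : ∀ᵐ x ∂D, x ∈ Icc (0 : ℝ) 1) (hc : c ∈ Icc (0 : ℝ) 1) {α β : ℝ}
    (hαβ : α ≤ β) {f : Rule n m} (hf : IsApproxEDMR c D β f) : IsApproxEDMR c D α f :=
  fun g hg σ =>
    (mul_le_mul_of_nonneg_right hαβ (expDistortion_nonneg hD hc g σ)).trans (hf g hg σ)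

theorem isApproxEDMR_of_forall_expDistortion_eq (hD : ∀ᵐ x ∂D, x ∈ Icc (0 : ℝ) 1)
    (hc : c ∈ Icc (0 : ℝ) 1) {ε : ℝ} (hε : 0 < ε)
    (h : ∀ (f g : Rule n m) (σ : Profile n m), expDistortion c D f σ = expDistortion c D g σ)
    (f : Rule n m) : IsApproxEDMR c D (1 - ε) f := fun g _ σ => by
  rw [h f g σ]
  nlinarith [expDistortion_nonneg hD hc g σ]

end

/-! ### Concentration for many voters -/

/-- Bias-variance decomposition: `φ` stays within 1 of its mean and the cross term integrates to 0.
This is the one-coordinate step of the induction below. -/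
theorem integral_sub_sq_le {α : Type*} [MeasurableSpace α] {ν : Measure α} [IsProbabilityMeasure ν]
    {φ : α → ℝ} {b : ℝ} (hφ : Measurable φ) (hb : ∀ a, |φ a| ≤ b)
    (hosc : ∀ a a', |φ a - φ a'| ≤ 1) (c : ℝ) :
    ∫ a, (φ a - c) ^ 2 ∂ν ≤ 1 + (∫ a, φ a ∂ν - c) ^ 2 := by
  have hint : Integrable φ ν := .of_bound hφ.aestronglyMeasurable b (.of_forall hb)
  set M := ∫ a, φ a ∂ν
  have hM : ∀ a, |φ a - M| ≤ 1 := fun a => by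
    have : φ a - M = ∫ a', (φ a - φ a') ∂ν := by
      rw [integral_sub (integrable_const _) hint]; simp [M]
    rw [this]
    simpa using norm_integral_le_of_norm_le_const (μ := ν) (f := fun a' => φ a - φ a') (C := 1)
      (.of_forall (hosc a))
  have hlin : Integrable (fun a => 2 * (M - c) * (φ a - M)) ν :=
    (hint.sub (integrable_const M)).const_mul _
  have hcalc : ∫ a, (1 + (M - c) ^ 2 + 2 * (M - c) * (φ a - M)) ∂ν = 1 + (M - c) ^ 2 := by
    rw [integral_add (integrable_const _) hlin, integral_const_mul,
      integral_sub hint (integrable_const M)]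
    simp [M]
  rw [← hcalc]
  refine integral_mono_of_nonneg (.of_forall fun a => sq_nonneg _)
    ((integrable_const _).add hlin) (.of_forall fun a => ?_)
  have h1 : (φ a - M) ^ 2 ≤ 1 := (sq_le_one_iff_abs_le_one _).mpr (hM a)
  change (φ a - c) ^ 2 ≤ 1 + (M - c) ^ 2 + 2 * (M - c) * (φ a - M)
  nlinarith

/-- A weak form of the Efron-Stein inequality: a function of `n` independent variables that changes
by at most `1` when one of the variables changes has variance at most `n`. -/
theorem integral_sub_sq_le_of_bounded_differences {α : Type*} [MeasurableSpace α] (ν : Measure α)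
    [IsProbabilityMeasure ν] {b : ℝ} (n : ℕ) (f : (Fin n → α) → ℝ) (hf : Measurable f)
    (hb : ∀ x, |f x| ≤ b) (hd : ∀ x y i, (∀ j, j ≠ i → x j = y j) → |f x - f y| ≤ 1) :
    ∫ x, (f x - ∫ y, f y ∂Measure.pi fun _ => ν) ^ 2 ∂(Measure.pi fun _ => ν) ≤ n := by
  induction n with
  | zero =>
    have : ∀ x, f x = f Fin.elim0 := fun x => congrArg f (Subsingleton.elim _ _)
    simp [this]
  | succ n ih =>
    have hcons : Measurable fun p : α × (Fin n → α) => (Fin.cons p.1 p.2 : Fin (n + 1) → α) := by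
      refine measurable_pi_lambda _ fun i => ?_
      refine Fin.cases ?_ (fun i => ?_) i
      · simpa using measurable_fst
      · simpa [Function.comp_def] using (measurable_pi_apply i).comp measurable_snd
    have hfc : Measurable fun p : α × (Fin n → α) => f (Fin.cons p.1 p.2) := hf.comp hcons
    -- Averaging out the first coordinate keeps the mean, the bound and the bounded differences, and
    -- costs at most 1 in variance.
    set h : (Fin n → α) → ℝ := fun z => ∫ a, f (Fin.cons a z) ∂ν with hh
    have hh_meas : Measurable h :=
      (hfc.stronglyMeasurable.integral_prod_left').measurable
    have hcz : ∀ z, Measurable fun a => f (Fin.cons a z) := fun z =>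
      hfc.comp (measurable_id.prodMk measurable_const)
    have hint : ∀ z, Integrable (fun a => f (Fin.cons a z)) ν := fun z =>
      .of_bound (hcz z).aestronglyMeasurable b (.of_forall fun a => hb _)
    have hh_bound : ∀ z, |h z| ≤ b := fun z => by
      simpa using norm_integral_le_of_norm_le_const (μ := ν)
        (f := fun a => f (Fin.cons a z)) (C := b) (.of_forall fun a => hb _)
    have hh_diff : ∀ x y i, (∀ j, j ≠ i → x j = y j) → |h x - h y| ≤ 1 := fun x y i hxy => by
      rw [hh, ← integral_sub (hint x) (hint y)]
      suffices h : ∀ a, ‖f (Fin.cons a x) - f (Fin.cons a y)‖ ≤ 1 by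
        simpa using norm_integral_le_of_norm_le_const (μ := ν) (.of_forall h)
      intro a
      refine hd _ _ i.succ fun j => Fin.cases ?_ (fun j => ?_) j
      · simp
      · intro hj
        simpa using hxy j fun h => hj (h ▸ rfl)
    have hmp := (measurePreserving_piFinSuccAbove (fun _ : Fin (n + 1) => ν) 0).symm
    have htransfer : ∀ F : (Fin (n + 1) → α) → ℝ, ∫ x, F x ∂(Measure.pi fun _ => ν) =
        ∫ p, F (Fin.cons p.1 p.2) ∂(ν.prod (Measure.pi fun _ : Fin n => ν)) := fun F => by
      rw [← hmp.integral_comp' F]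
      simp [MeasurableEquiv.piFinSuccAbove, Fin.insertNthEquiv]
    have hmean : ∫ x, f x ∂(Measure.pi fun _ => ν) = ∫ z, h z ∂(Measure.pi fun _ => ν) := by
      rw [htransfer, integral_prod_symm]
      exact .of_bound hfc.aestronglyMeasurable b (.of_forall fun p => hb _)
    rw [hmean, htransfer]
    set M := ∫ z, h z ∂(Measure.pi fun _ => ν)
    have hsq : ∀ t, |t| ≤ b → ‖(t - M) ^ 2‖ ≤ (b + |M|) ^ 2 := fun t ht => by
      rw [norm_pow]
      gcongr
      exact (abs_sub t M).trans (by gcongr)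
    rw [integral_prod_symm _ (.of_bound ((hfc.sub_const M).pow_const 2).aestronglyMeasurable _
      (.of_forall fun p => hsq _ (hb _)))]
    have hhint : Integrable (fun z => (h z - M) ^ 2) (Measure.pi fun _ : Fin n => ν) :=
      .of_bound ((hh_meas.sub_const M).pow_const 2).aestronglyMeasurable _
        (.of_forall fun z => hsq _ (hh_bound z))
    calc _ ≤ ∫ z, (1 + (h z - M) ^ 2) ∂(Measure.pi fun _ : Fin n => ν) := by
          refine integral_mono_of_nonneg (.of_forall fun z => integral_nonneg fun a => sq_nonneg _)
            ((integrable_const _).add hhint) (.of_forall fun z => ?_)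
          refine integral_sub_sq_le (hcz z) (fun a => hb _) (fun a a' => ?_) M
          refine hd _ _ 0 fun j => Fin.cases ?_ (fun j => ?_) j
          · simp
          · simp
      _ ≤ 1 + (n : ℝ) := by
          rw [integral_add (integrable_const _) hhint]
          simpa using ih h hh_meas hh_bound hh_diff
      _ = ((n + 1 : ℕ) : ℝ) := by push_cast; ring

section
variable {D : Measure ℝ} [IsProbabilityMeasure D] {n m : ℕ}

theorem integral_maxWelfare_sub_sq_le [Nonempty (Fin m)] (hD : ∀ᵐ x ∂D, x ∈ Icc (0 : ℝ) 1)
    (σ : Profile n m) :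
    ∫ x, (maxWelfare σ x - ∫ y, maxWelfare σ y ∂drawLaw D n m) ^ 2 ∂drawLaw D n m ≤ n := by
  -- Bounded differences are required at every point, but the draws lie in `[0, 1]` only almost
  -- surely.
  let clip : (Fin n → Fin m → ℝ) → Fin n → Fin m → ℝ :=
    fun x i j => projIcc (0 : ℝ) 1 zero_le_one (x i j)
  have hclip_mem : ∀ x i j, clip x i j ∈ Icc (0 : ℝ) 1 := fun x i j => Subtype.prop _
  have hclip_meas : Measurable clip :=
    measurable_pi_lambda _ fun i => measurable_pi_lambda _ fun j =>
      (continuous_subtype_val.comp continuous_projIcc).measurable.comp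
        ((measurable_pi_apply j).comp (measurable_pi_apply i))
  have hae : ∀ᵐ x ∂drawLaw D n m, maxWelfare σ x = maxWelfare σ (clip x) := by
    filter_upwards [ae_drawLaw_mem hD n m] with x hx
    congr 1
    ext i j
    simp only [clip]
    rw [projIcc_of_mem _ (hx i j)]
  have key := integral_sub_sq_le_of_bounded_differences (b := n)
    (Measure.pi fun _ : Fin m => D) n (fun x => maxWelfare σ (clip x))
    ((measurable_maxWelfare σ).comp hclip_meas) (fun x => by
      have h := maxWelfare_mem σ (hclip_mem x)
      rw [abs_of_nonneg h.1]
      exact h.2) (fun x y i hxy => by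
      refine (abs_maxWelfare_sub_le (b := Pi.single i 1) σ fun i' k => ?_).trans (by simp)
      have h1 := descOrderStat_mem (hclip_mem x i') k
      have h2 := descOrderStat_mem (hclip_mem y i') k
      by_cases hi : i' = i
      · subst hi
        rw [Pi.single_eq_same, abs_le]
        constructor <;> linarith [h1.1, h1.2, h2.1, h2.2]
      · have : clip x i' = clip y i' := by
          ext j
          simp only [clip, hxy i' hi]
        simp [this, hi])
  rw [integral_congr_ae hae]
  refine le_trans (le_of_eq (integral_congr_ae ?_)) key
  filter_upwards [hae] with x hx
  rw [hx]
  rfl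

theorem integral_abs_maxWelfare_sub_le_of_sq [Nonempty (Fin m)]
    (hD : ∀ᵐ x ∂D, x ∈ Icc (0 : ℝ) 1) (σ : Profile n m) {κ : ℝ} (hκ : 0 < κ)
    (hn : 1 / κ ^ 2 ≤ n) :
    ∫ x, |maxWelfare σ x - ∫ y, maxWelfare σ y ∂drawLaw D n m| ∂drawLaw D n m ≤ n * κ := by
  have hn0 : (0 : ℝ) < n := (by positivity : 0 < 1 / κ ^ 2).trans_le hn
  set A := ∫ y, maxWelfare σ y ∂drawLaw D n m with hA
  have hsq : Integrable (fun x => (maxWelfare σ x - A) ^ 2) (drawLaw D n m) := by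
    refine .of_bound (((measurable_maxWelfare σ).sub_const A).pow_const 2).aestronglyMeasurable
      ((n + |A|) ^ 2) ?_
    filter_upwards [ae_drawLaw_mem hD n m] with x hx
    have h := maxWelfare_mem σ hx
    rw [norm_pow]
    gcongr
    refine (abs_sub _ _).trans ?_
    rw [abs_of_nonneg h.1]
    gcongr
    exact h.2
  -- AM-GM in place of Cauchy-Schwarz; the variance bound turns the first term into `1 / (2 * κ)`,
  -- at most `n * κ / 2` by `hn`.
  calc ∫ x, |maxWelfare σ x - A| ∂drawLaw D n m
      ≤ ∫ x, ((maxWelfare σ x - A) ^ 2 / (2 * (n * κ)) + n * κ / 2) ∂drawLaw D n m := by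
        refine integral_mono ((integrable_maxWelfare hD σ).sub (integrable_const A)).abs
          ((hsq.div_const _).add (integrable_const _)) fun x => ?_
        have hpos : 0 < n * κ := by positivity
        change |maxWelfare σ x - A| ≤ (maxWelfare σ x - A) ^ 2 / (2 * (n * κ)) + n * κ / 2
        rw [← sq_abs (maxWelfare σ x - A)]
        rw [← sub_nonneg]
        have heq : |maxWelfare σ x - A| ^ 2 / (2 * (n * κ)) + n * κ / 2 - |maxWelfare σ x - A| =
            (|maxWelfare σ x - A| - n * κ) ^ 2 / (2 * (n * κ)) := by
          field_simp; ring
        rw [heq]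
        positivity
    _ ≤ n / (2 * (n * κ)) + n * κ / 2 := by
        rw [integral_add (hsq.div_const _) (integrable_const _), integral_div]
        simp only [integral_const, probReal_univ, smul_eq_mul, one_mul]
        gcongr
        exact integral_maxWelfare_sub_sq_le hD σ
    _ ≤ n * κ := by
        have : n / (2 * (n * κ)) = 1 / κ ^ 2 * (κ / 2) := by field_simp
        rw [this]
        have := mul_le_mul_of_nonneg_right hn (by positivity : 0 ≤ κ / 2)
        linarith

end

/-! ### Concentration for many alternatives -/

section
variable {D : Measure ℝ} [IsProbabilityMeasure D] {n m : ℕ}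

/-- Compare `x` with a second sample `y`: a voter contributes at most `δ` if both of its draws avoid
`B`, and at most 1 otherwise. Each sample has `n * p` voters in `B` on average, whence the factor 2.
-/
theorem integral_abs_maxWelfare_sub_le_of_set [Nonempty (Fin m)]
    (hD : ∀ᵐ x ∂D, x ∈ Icc (0 : ℝ) 1) (σ : Profile n m) {B : Set (Fin m → ℝ)}
    (hB : MeasurableSet B) {δ : ℝ} (hδ : 0 ≤ δ)
    (hosc : ∀ x y : Fin m → ℝ, (∀ j, x j ∈ Icc (0 : ℝ) 1) → (∀ j, y j ∈ Icc (0 : ℝ) 1) → x ∉ B →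
      y ∉ B → ∀ k, |descOrderStat x k - descOrderStat y k| ≤ δ) :
    ∫ x, |maxWelfare σ x - ∫ y, maxWelfare σ y ∂drawLaw D n m| ∂drawLaw D n m ≤
      n * (δ + 2 * (Measure.pi fun _ : Fin m => D).real B) := by
  set p := (Measure.pi fun _ : Fin m => D).real B
  let χ : (Fin m → ℝ) → ℝ := B.indicator fun _ => 1
  have hχ0 : ∀ x, 0 ≤ χ x := fun x => indicator_nonneg (fun _ _ => zero_le_one) x
  have hχint : Integrable χ (Measure.pi fun _ : Fin m => D) :=
    (integrable_const 1).indicator hB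
  let b : (Fin n → Fin m → ℝ) → ℝ := fun x => ∑ i, χ (x i)
  have hevint : ∀ i : Fin n, Integrable (fun x : Fin n → Fin m → ℝ => χ (x i)) (drawLaw D n m) :=
    fun i => integrable_comp_eval hχint
  have hbint : Integrable b (drawLaw D n m) := integrable_finsetSum _ fun i _ => hevint i
  have hbmean : ∫ x, b x ∂drawLaw D n m = n * p := by
    simp only [b]
    rw [integral_finsetSum _ fun i _ => hevint i]
    have : ∀ i : Fin n, ∫ x, χ (x i) ∂drawLaw D n m = p := fun i => by
      refine (integral_comp_eval (μ := fun _ : Fin n => Measure.pi fun _ : Fin m => D) (i := i)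
        (f := χ) hχint.aestronglyMeasurable).trans ?_
      simp [χ, integral_indicator hB, p]
    simp [this]
  have hpair : ∀ x y : Fin n → Fin m → ℝ, (∀ i j, x i j ∈ Icc (0 : ℝ) 1) →
      (∀ i j, y i j ∈ Icc (0 : ℝ) 1) → |maxWelfare σ x - maxWelfare σ y| ≤ n * δ + b x + b y := by
    intro x y hx hy
    refine (abs_maxWelfare_sub_le (b := fun i => δ + χ (x i) + χ (y i)) σ fun i k => ?_).trans
      (by simp [Finset.sum_add_distrib, b])
    by_cases hxB : x i ∈ B
    · have h1 := descOrderStat_mem (hx i) k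
      have h2 := descOrderStat_mem (hy i) k
      have h3 : χ (x i) = 1 := indicator_of_mem hxB _
      have h4 := hχ0 (y i)
      rw [abs_le]
      constructor <;> linarith [h1.1, h1.2, h2.1, h2.2]
    by_cases hyB : y i ∈ B
    · have h1 := descOrderStat_mem (hx i) k
      have h2 := descOrderStat_mem (hy i) k
      have h3 : χ (y i) = 1 := indicator_of_mem hyB _
      have h4 := hχ0 (x i)
      rw [abs_le]
      constructor <;> linarith [h1.1, h1.2, h2.1, h2.2]
    · linarith [hosc (x i) (y i) (hx i) (hy i) hxB hyB k, hχ0 (x i), hχ0 (y i)]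
  have hW := integrable_maxWelfare hD σ
  calc _ ≤ ∫ x, (n * δ + n * p + b x) ∂drawLaw D n m := by
        refine integral_mono_ae (hW.sub (integrable_const _)).abs
          ((integrable_const _).add hbint) ?_
        filter_upwards [ae_drawLaw_mem hD n m] with x hx
        have h1 : maxWelfare σ x - ∫ y, maxWelfare σ y ∂drawLaw D n m =
            ∫ y, (maxWelfare σ x - maxWelfare σ y) ∂drawLaw D n m := by
          rw [integral_sub (integrable_const _) hW]; simp
        have h2 : ∫ y, (n * δ + b x + b y) ∂drawLaw D n m = n * δ + n * p + b x := by
          rw [integral_add (integrable_const _) hbint, hbmean]; simp; ring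
        rw [h1, ← h2]
        refine abs_integral_le_integral_abs.trans (integral_mono_ae
          ((integrable_const _).sub hW).abs ((integrable_const _).add hbint) ?_)
        filter_upwards [ae_drawLaw_mem hD n m] with y hy using hpair x y hx hy
    _ = n * (δ + 2 * p) := by
        rw [integral_add (integrable_const _) hbint, hbmean]; simp; ring

/-- Chebyshev's inequality for the number of draws above a threshold. -/
theorem measureReal_abs_card_sub_ge_le (D : Measure ℝ) [IsProbabilityMeasure D] {m : ℕ}
    (hm : 0 < m) (t : ℝ) {κ : ℝ} (hκ : 0 < κ) :
    (Measure.pi fun _ : Fin m => D).real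
      {x | m * κ ≤ |(Finset.card {j | t < x j} : ℝ) - m * D.real (Ioi t)|} ≤ 1 / (m * κ ^ 2) := by
  let χ : ℝ → ℝ := (Ioi t).indicator fun _ => 1
  have hχ : MemLp χ 2 D := (memLp_const 1).indicator measurableSet_Ioi
  let X : (Fin m → ℝ) → ℝ := ∑ j, fun x => χ (x j)
  have hXcard : ∀ x, X x = Finset.card {j | t < x j} := fun x => by
    simp [X, χ, indicator_apply, Finset.sum_apply]
  have hX : MemLp X 2 (Measure.pi fun _ : Fin m => D) :=
    memLp_finsetSum' _ fun j _ =>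
      hχ.comp_measurePreserving (measurePreserving_eval (fun _ : Fin m => D) j)
  have hmean : ∫ x, X x ∂(Measure.pi fun _ : Fin m => D) = m * D.real (Ioi t) := by
    simp only [X, Finset.sum_apply]
    rw [integral_finsetSum _ fun j _ => integrable_comp_eval (hχ.integrable (by norm_num))]
    have : ∀ j : Fin m, ∫ x, χ (x j) ∂(Measure.pi fun _ : Fin m => D) = D.real (Ioi t) :=
      fun j => by
        refine (integral_comp_eval (μ := fun _ : Fin m => D) (i := j) (f := χ)
          hχ.aestronglyMeasurable).trans ?_
        simp [χ, integral_indicator measurableSet_Ioi]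
    simp [this]
  have hvar : Var[X; Measure.pi fun _ : Fin m => D] ≤ m := by
    rw [variance_sum_pi fun _ => hχ]
    have h1 : Var[χ; D] ≤ 1 := by
      refine (variance_le_expectation_sq hχ.aestronglyMeasurable).trans ?_
      refine (integral_mono_of_nonneg (g := fun _ => (1 : ℝ)) (.of_forall fun a => sq_nonneg _)
        (integrable_const 1) (.of_forall fun a => ?_)).trans (by simp)
      by_cases ha : a ∈ Ioi t <;> simp [χ, ha]
    simpa using mul_le_mul_of_nonneg_left h1 (Nat.cast_nonneg m)
  have hm' : (0 : ℝ) < m := by exact_mod_cast hm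
  have hcheb := meas_ge_le_variance_div_sq hX (c := m * κ) (by positivity)
  rw [hmean] at hcheb
  simp only [hXcard] at hcheb
  refine (ENNReal.toReal_le_of_le_ofReal
    (div_nonneg (variance_nonneg _ _) (sq_nonneg _)) hcheb).trans ?_
  calc _ ≤ m / (m * κ) ^ 2 := by gcongr
    _ = 1 / (m * κ ^ 2) := by field_simp

theorem exists_pos_forall_lt_le {G : ℕ → ℝ} (N : ℕ) (h : ∀ i < N, 0 < G i) :
    ∃ κ > 0, ∀ i < N, κ ≤ G i := by
  induction N with
  | zero => exact ⟨1, one_pos, by simp⟩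
  | succ N ih =>
    obtain ⟨κ, hκ, hle⟩ := ih fun i hi => h i (by omega)
    refine ⟨min κ (G N), lt_min hκ (h N (by omega)), fun i hi => ?_⟩
    rcases Nat.lt_succ_iff_lt_or_eq.mp hi with hi | rfl
    · exact (min_le_left _ _).trans (hle i hi)
    · exact min_le_right _ _

/-- If the empirical tails of `x` and `y` are uniformly close to a strictly decreasing function at
the multiples of `1 / N`, then the order statistics of `x` and `y` differ by at most `2 / N`. -/
theorem abs_descOrderStat_sub_le {N : ℕ} (hN : 0 < N) {G : ℝ → ℝ} {κ : ℝ}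
    (hG : ∀ i : ℕ, i + 1 < N → 2 * κ ≤ G (i / N) - G ((i + 1 : ℕ) / N)) {x y : Fin m → ℝ}
    (hx : ∀ j, x j ∈ Icc (0 : ℝ) 1) (hy : ∀ j, y j ∈ Icc (0 : ℝ) 1)
    (hxG : ∀ i < N, |(Finset.card {j | (i / N : ℝ) < x j} : ℝ) - m * G (i / N)| < m * κ)
    (hyG : ∀ i < N, |(Finset.card {j | (i / N : ℝ) < y j} : ℝ) - m * G (i / N)| < m * κ)
    (k : Fin m) : |descOrderStat x k - descOrderStat y k| ≤ 2 / N := by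
  have key : ∀ x y : Fin m → ℝ, (∀ j, x j ∈ Icc (0 : ℝ) 1) → (∀ j, y j ∈ Icc (0 : ℝ) 1) →
      (∀ i < N, |(Finset.card {j | (i / N : ℝ) < x j} : ℝ) - m * G (i / N)| < m * κ) →
      (∀ i < N, |(Finset.card {j | (i / N : ℝ) < y j} : ℝ) - m * G (i / N)| < m * κ) →
      descOrderStat y k ≤ descOrderStat x k + 2 / N := by
    intro x y hx hy hxG hyG
    by_contra! hlt
    have hN' : (0 : ℝ) < N := by exact_mod_cast hN
    have hx0 := (descOrderStat_mem hx k).1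
    have hy1 := (descOrderStat_mem hy k).2
    -- A gap above `2 / N` contains a whole grid cell `[i / N, (i + 1) / N]`. At most `k` entries of
    -- `x` exceed its left end and more than `k` entries of `y` its right end, whereas `G` drops by
    -- `2 * κ` across it.
    set i := ⌈N * descOrderStat x k⌉₊
    have hi1 : descOrderStat x k ≤ i / N := by
      rw [le_div_iff₀ hN', mul_comm]; exact Nat.le_ceil _
    have hi2 : ((i + 1 : ℕ) : ℝ) / N < descOrderStat y k := by
      refine lt_of_le_of_lt ?_ hlt
      rw [div_le_iff₀ hN', add_mul, div_mul_cancel₀ _ hN'.ne']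
      have := Nat.ceil_lt_add_one (a := N * descOrderStat x k) (by positivity)
      push_cast
      linarith
    have hiN : i + 1 < N := by
      have := hi2.trans_le hy1
      rw [div_lt_one hN'] at this
      exact_mod_cast this
    have h1 : (Finset.card {j | (i / N : ℝ) < x j} : ℝ) ≤ (k : ℕ) := by
      exact_mod_cast not_lt.mp fun h => hi1.not_gt ((lt_descOrderStat_iff x k _).mpr h)
    have h2 : ((k : ℕ) : ℝ) < Finset.card {j | (((i + 1 : ℕ) : ℝ) / N) < y j} := by
      exact_mod_cast (lt_descOrderStat_iff y k _).mp hi2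
    have h3 := (abs_lt.mp (hxG i (by omega))).1
    have h4 := (abs_lt.mp (hyG (i + 1) hiN)).2
    have h5 := mul_le_mul_of_nonneg_left (hG i hiN) (Nat.cast_nonneg (α := ℝ) m)
    linarith
  rw [abs_le]
  have h1 := key x y hx hy hxG hyG
  have h2 := key y x hy hx hyG hxG
  constructor <;> linarith

/-- If the tail of `D` is strictly decreasing on `[0, 1)` then the largest welfare concentrates as
the number of alternatives grows, uniformly in the number of voters. -/
theorem exists_forall_integral_abs_maxWelfare_sub_le (D : Measure ℝ) [IsProbabilityMeasure D]
    (hD : ∀ᵐ x ∂D, x ∈ Icc (0 : ℝ) 1)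
    (hanti : StrictAntiOn (fun t => D.real (Ioi t)) (Ico (0 : ℝ) 1)) {η : ℝ} (hη : 0 < η) :
    ∃ m₀ : ℕ, ∀ n m : ℕ, m₀ ≤ m → 0 < m → ∀ σ : Profile n m,
      ∫ x, |maxWelfare σ x - ∫ y, maxWelfare σ y ∂drawLaw D n m| ∂drawLaw D n m ≤ n * η := by
  -- Makes the oscillation `2 / N` at most `η / 2`; the choice of `m₀` below brings twice the bad
  -- probability under the other half.
  obtain ⟨N, hNη⟩ := exists_nat_gt (4 / η)
  have hN' : (0 : ℝ) < N := (by positivity : 0 < 4 / η).trans hNη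
  have hN : 0 < N := by exact_mod_cast hN'
  -- Only `N - 1` gaps: the last cell ends at 1, where strict decrease is not available.
  obtain ⟨κ', hκ', hgap'⟩ := exists_pos_forall_lt_le
    (G := fun i : ℕ => D.real (Ioi (i / N : ℝ)) - D.real (Ioi (((i + 1 : ℕ) : ℝ) / N))) (N - 1)
    fun i hi => by
      have hiN : ((i + 1 : ℕ) : ℝ) < N := by exact_mod_cast (by omega : i + 1 < N)
      have hlt : (i : ℝ) / N < ((i + 1 : ℕ) : ℝ) / N := by gcongr; linarith
      have hlt1 : ((i + 1 : ℕ) : ℝ) / N < 1 := (div_lt_one hN').mpr hiN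
      exact sub_pos.mpr (hanti ⟨by positivity, hlt.trans hlt1⟩ ⟨by positivity, hlt1⟩ hlt)
  set κ := κ' / 2
  have hκ : 0 < κ := by positivity
  have hgap : ∀ i : ℕ, i + 1 < N →
      2 * κ ≤ D.real (Ioi (i / N : ℝ)) - D.real (Ioi (((i + 1 : ℕ) : ℝ) / N)) := fun i hi => by
    have := hgap' i (by omega)
    simp only [κ]
    linarith
  obtain ⟨m₀, hm₀⟩ := exists_nat_ge (4 * N / (κ ^ 2 * η))
  refine ⟨m₀, fun n m hm hmpos σ => ?_⟩
  have : Nonempty (Fin m) := ⟨⟨0, hmpos⟩⟩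
  have hm' : (0 : ℝ) < m := by exact_mod_cast hmpos
  let S : ℕ → Set (Fin m → ℝ) := fun i =>
    {x | m * κ ≤ |(Finset.card {j | (i / N : ℝ) < x j} : ℝ) - m * D.real (Ioi (i / N : ℝ))|}
  have hS : ∀ i, MeasurableSet (S i) := fun i => by
    refine measurableSet_le measurable_const (Measurable.abs (Measurable.sub_const ?_ _))
    simp_rw [Finset.card_filter, Nat.cast_sum]
    refine Finset.measurable_sum _ fun j _ => Measurable.comp measurable_from_top ?_
    exact Measurable.ite (measurableSet_lt measurable_const (measurable_pi_apply j))
      measurable_const measurable_const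
  have hSp : (Measure.pi fun _ : Fin m => D).real (⋃ i ∈ Finset.range N, S i) ≤
      N * (1 / (m * κ ^ 2)) := by
    refine (measureReal_biUnion_finset_le _ _).trans ?_
    calc _ ≤ ∑ _i ∈ Finset.range N, 1 / (m * κ ^ 2) := Finset.sum_le_sum fun i _ =>
          measureReal_abs_card_sub_ge_le D hmpos (i / N : ℝ) hκ
      _ = N * (1 / (m * κ ^ 2)) := by simp
  refine (integral_abs_maxWelfare_sub_le_of_set hD σ (B := ⋃ i ∈ Finset.range N, S i)
    (Finset.measurableSet_biUnion _ fun i _ => hS i) (δ := 2 / N) (by positivity)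
    fun x y hx hy hxB hyB => ?_).trans ?_
  · simp only [S, mem_iUnion, Finset.mem_range, mem_ofPred_eq, not_exists, not_le] at hxB hyB
    exact abs_descOrderStat_sub_le (G := fun t => D.real (Ioi t)) hN hgap hx hy hxB hyB
  · gcongr
    have h1 : 2 / (N : ℝ) ≤ η / 2 := by
      rw [div_lt_iff₀ hη] at hNη
      rw [div_le_iff₀ hN']
      linarith
    have h2 : N * (1 / (m * κ ^ 2)) ≤ η / 4 := by
      have := hm₀.trans (Nat.cast_le.mpr hm)
      rw [div_le_iff₀ (by positivity)] at this
      rw [mul_one_div, div_le_iff₀ (by positivity)]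
      linarith
    linarith

theorem strictAntiOn_measureReal_Ioi (D : Measure ℝ) [IsProbabilityMeasure D]
    (hF : StrictMonoOn (fun x => cdf D x) (Ioo (0 : ℝ) 1)) :
    StrictAntiOn (fun t => D.real (Ioi t)) (Ico (0 : ℝ) 1) := by
  have htail : ∀ t, D.real (Ioi t) = 1 - cdf D t := fun t => by
    rw [← compl_Iic, probReal_compl_eq_one_sub measurableSet_Iic, cdf_eq_real]
  intro s hs t ht hst
  simp only [htail]
  -- The left point may be 0, outside the interval of strict growth; the midpoint is inside, and
  -- plain monotonicity handles the rest.
  have hmid : (s + t) / 2 ∈ Ioo (0 : ℝ) 1 := ⟨by linarith [hs.1], by linarith [ht.2]⟩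
  have h1 := hF hmid ⟨hs.1.trans_lt hst, ht.2⟩ (by linarith : (s + t) / 2 < t)
  have h2 := monotone_cdf D (by linarith : s ≤ (s + t) / 2)
  simp only at h1
  linarith

theorem integral_pos_of_strictAntiOn (hD : ∀ᵐ x ∂D, x ∈ Icc (0 : ℝ) 1)
    (hanti : StrictAntiOn (fun t => D.real (Ioi t)) (Ico (0 : ℝ) 1)) : 0 < ∫ x, x ∂D := by
  have hnn : 0 ≤ᵐ[D] fun x => x := by filter_upwards [hD] with x hx using hx.1
  have hint : Integrable (fun x : ℝ => x) D := .of_mem_Icc 0 1 measurable_id.aemeasurable hD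
  refine (integral_nonneg_of_ae hnn).lt_of_ne' fun h0 => ?_
  have hzero := (integral_eq_zero_iff_of_nonneg_ae hnn hint).mp h0
  have h1 : D.real (Ioi 0) = 0 := by
    rw [measureReal_eq_zero_iff, measure_eq_zero_iff_ae_notMem]
    filter_upwards [hzero] with x hx
    simp [hx]
  have h2 := hanti ⟨le_rfl, one_pos⟩ ⟨by norm_num, by norm_num⟩ (by norm_num : (0 : ℝ) < 1 / 2)
  simp only [h1] at h2
  exact h2.not_ge measureReal_nonneg

end

theorem expDistortion_eq_of_ae_zero {D : Measure ℝ} [IsProbabilityMeasure D] {n m : ℕ} {c : ℝ}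
    (hD : ∀ᵐ x ∂D, x = 0) (f : Rule n m) (σ : Profile n m) : expDistortion c D f σ = c := by
  have : ∀ᵐ x ∂drawLaw D n m, welfareRatio c (utility σ x) (f σ) = c := by
    filter_upwards [ae_drawLaw_mem (s := {0}) hD n m] with x hx
    have hw : ∀ j, welfare (utility σ x) j = 0 := fun j =>
      Finset.sum_eq_zero fun i _ => descOrderStat_mem (hx i) (σ i j)
    simp [welfareRatio, hw]
  unfold expDistortion
  rw [integral_congr_ae this]
  simp

end Voting

theorem mainTheorem3 :
    (∀ (μ s ε : ℝ), 0 < ε → ∃ n₀ : ℕ,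
      ∀ (D : Measure ℝ) [IsProbabilityMeasure D],
        (∀ᵐ x ∂D, x ∈ Set.Icc (0 : ℝ) 1) →
        (∫ x, x ∂D) = μ →
        ProbabilityTheory.variance (fun x : ℝ => x) D = s ^ 2 →
        ∀ (c : ℝ), c ∈ Set.Icc (0 : ℝ) 1 →
        ∀ (n m : ℕ), n₀ ≤ n →
        ∀ f : Voting.Rule n m, Voting.IsEWMR D f → Voting.IsApproxEDMR c D (1 - ε) f) ∧
    (∀ (D : Measure ℝ) [IsProbabilityMeasure D],
      (∀ᵐ x ∂D, x ∈ Set.Icc (0 : ℝ) 1) →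
      ContDiffOn ℝ 1 (fun x : ℝ => ProbabilityTheory.cdf D x) (Set.Ioo (0 : ℝ) 1) →
      (∀ x ∈ Set.Ioo (0 : ℝ) 1, 0 < deriv (fun y : ℝ => ProbabilityTheory.cdf D y) x) →
      ∀ (ε : ℝ), 0 < ε → ∃ m₀ : ℕ,
        ∀ (c : ℝ), c ∈ Set.Icc (0 : ℝ) 1 →
        ∀ (n m : ℕ), m₀ ≤ m →
        ∀ f : Voting.Rule n m, Voting.IsEWMR D f → Voting.IsApproxEDMR c D (1 - ε) f) := by
  constructor
  · intro μ s ε hε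
    by_cases hμ : 0 < μ
    swap
    -- A nonpositive mean forces all mass to 0, so every rule has expected distortion `c`.
    · refine ⟨0, fun D _ hD hDμ _ c hc n m _ f _ => ?_⟩
      have hnn : 0 ≤ᵐ[D] fun x => x := by filter_upwards [hD] with x hx using hx.1
      have hzero := (integral_eq_zero_iff_of_nonneg_ae hnn
        (.of_mem_Icc 0 1 measurable_id.aemeasurable hD)).mp
        (le_antisymm (hDμ.le.trans (not_lt.mp hμ)) (integral_nonneg_of_ae hnn))
      exact Voting.isApproxEDMR_of_forall_expDistortion_eq hD hc hε (fun f g σ => by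
        rw [Voting.expDistortion_eq_of_ae_zero hzero, Voting.expDistortion_eq_of_ae_zero hzero]) f
    have hε' : 0 < min ε 1 := lt_min hε one_pos
    -- Built from `μ` and `ε` alone, so `n₀` serves all `D` and `m`.
    set κ := μ * (min ε 1 * μ / 3) with hκdef
    have hκ : 0 < κ := by positivity
    obtain ⟨n₀, hn₀⟩ := exists_nat_ge (1 / κ ^ 2)
    refine ⟨n₀, fun D _ hD hDμ _ c hc n m hn f hf => ?_⟩
    have hnκ : 1 / κ ^ 2 ≤ n := hn₀.trans (Nat.cast_le.mpr hn)
    have hn' : 0 < n := by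
      have : (0 : ℝ) < n := (by positivity : 0 < 1 / κ ^ 2).trans_le hnκ
      exact_mod_cast this
    refine (Voting.isApproxEDMR_of_concentration hD hc (hDμ ▸ hμ) hn' hε' (min_le_right _ _)
      (κ := κ) (by rw [hDμ]) (fun σ => ?_) hf).mono hD hc
      (sub_le_sub_left (min_le_left ε 1) 1)
    have : Nonempty (Fin m) := ⟨f σ⟩
    exact Voting.integral_abs_maxWelfare_sub_le_of_sq hD σ hκ hnκ
  · intro D _ hD hF hF' ε hε
    have hanti := Voting.strictAntiOn_measureReal_Ioi D
      (strictMonoOn_of_deriv_pos (convex_Ioo 0 1) hF.continuousOn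
        (by simpa only [interior_Ioo] using hF'))
    have hμ := Voting.integral_pos_of_strictAntiOn hD hanti
    have hε' : 0 < min ε 1 := lt_min hε one_pos
    set κ := (∫ x, x ∂D) * (min ε 1 * (∫ x, x ∂D) / 3)
    have hκ : 0 < κ := by positivity
    obtain ⟨m₀, hm₀⟩ := Voting.exists_forall_integral_abs_maxWelfare_sub_le D hD hanti hκ
    refine ⟨m₀, fun c hc n m hm f hf => ?_⟩
    -- Without voters every welfare is an empty sum, so all rules tie.
    rcases Nat.eq_zero_or_pos n with rfl | hn
    · exact Voting.isApproxEDMR_of_forall_expDistortion_eq hD hc hε (fun f g σ => by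
        simp [Voting.expDistortion, Voting.welfareRatio, Voting.welfare]) f
    · exact (Voting.isApproxEDMR_of_concentration hD hc hμ hn hε' (min_le_right _ _) le_rfl
        (fun σ => hm₀ n m hm (Nat.zero_lt_of_lt (f σ).isLt) σ) hf).mono hD hc
        (sub_le_sub_left (min_le_left ε 1) 1)
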